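/- Field-independent code sparsification. For a finite field $\mathbb{F}_q$ and a linear code (linear subspace) $C \subseteq \mathbb{F}_q^m$, a $(1\pm\epsilon)$ sparsifier of $C$ is a weight function $w : \{1,\dots,m\} \to \mathbb{R}_{\ge 0}$ such that for every $c \in C$ $$(1-\epsilon)\sum_{i=1}^m \mathbf 1[c_i \neq 0] \;\le\; \sum_{i=1}^m w(i)\,\mathbf 1[c_i\neq 0] \;\le\; (1+\epsilon)\sum_{i=1}^m \mathbf 1[c_i \neq 0];$$ its size is the number of coordinates it retains, $|\operatorname{supp}(w)| = |\{i : w(i) \neq 0\}|$. Theorem. Every linear code of dimension $n$ has a $(1\pm\epsilon)$ sparsifier of size at most $n\cdot\log^{2+o(1)}(n/\epsilon)/\epsilon^2$, where the $o(1)$ refers to $n/\epsilon\to\infty$ and is independent of the field, of the length and of the code. Precisely: there are a function $\delta:\mathbb{R}\to\mathbb{R}$ with $\delta(x)\to 0$ as $x\to\infty$ and constants $x_0, K \in \mathbb{R}$ such that for every finite field $\mathbb{F}_q$, all integers $m,n\ge 0$, every linear code $C\subseteq\mathbb{F}_q^m$ of dimension $n$ and every real $\epsilon>0$, the code $C$ has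 a $(1\pm\epsilon)$ sparsifier $w$ with $$|\operatorname{supp}(w)| \le \frac{n\,\bigl(\log (n/\epsilon)\bigr)^{2+\delta(n/\epsilon)}}{\epsilon^2}\quad\text{if } n/\epsilon\ge x_0, \qquad |\operatorname{supp}(w)| \le \frac{K\,n}{\epsilon^2}\quad\text{if } n/\epsilon< x_0 .$$ -/

import Mathlib

open Filter Topology
open scoped NNReal

/-- The weight of the word `c` when the coordinate `i` counts `w i`:
`∑ i, w i * 1[c i ≠ 0]`. -/
noncomputable def weightedHammingWeight {F : Type*} [Field F] {m : ℕ}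
    (w : Fin m → ℝ≥0) (c : Fin m → F) : ℝ :=
  open Classical in ∑ i, (w i : ℝ) * (if c i ≠ 0 then 1 else 0)

/-- The reweighting `w` of the coordinates is a `(1 ± ε)` sparsifier of the linear code `C`:
the reweighted Hamming weight of every codeword agrees with its Hamming weight (all coordinates
counted once) up to a factor in `[1 - ε, 1 + ε]`. -/
def IsCodeSparsifier {F : Type*} [Field F] {m : ℕ}
    (C : Submodule F (Fin m → F)) (ε : ℝ) (w : Fin m → ℝ≥0) : Prop :=
  ∀ c ∈ C,
    (1 - ε) * weightedHammingWeight 1 c ≤ weightedHammingWeight w c ∧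
      weightedHammingWeight w c ≤ (1 + ε) * weightedHammingWeight 1 c

/-! Random halving with a union bound over supports of codewords rather than over codewords, which
removes the field size. Call a code `κ`-strong if every subcode of dimension `d` meets at least `κ *
d` coordinates. A contraction argument in the style of Karger's cut counting shows that such a code
has at most `μ ^ (3 * a)` supports of size at most `a * κ`, where `μ` exceeds the length
(`IsStrongCode.card_lightSupports_le`). With `κ` of order `log μ / η ^ 2`, random signs therefore
have discrepancy at most `η * |Q|` on all supports `Q` at once (`IsStrongCode.sum_exp_le`,
`exists_boolSign_sum_le`).

An arbitrary code need not be strong, but strong coordinate sets are closed under union, so every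
set has a largest strong subset, and a set without nonempty strong subsets has at most `κ * dim C`
elements. In a weighted code, each coordinate is tested in the strong core of the coordinates at
least as heavy. Those that lie in their core are doubled or deleted at random; the others, at most
`κ * dim C` of them, are kept. Summation by parts over the levels bounds the weighted error
(`exists_halving`).

Halving is repeated with relative errors that decrease geometrically in the number of steps still to
come. The total error stays below `ε` whatever the initial length, and the final size is `O(n * log
(n / ε) / ε ^ 2)`, so `δ = 0` suffices. -/

/-! ### Strong codes and the number of light supports. -/

section Codes

variable {ι F : Type*} [Fintype ι] [Field F]

set_option linter.unusedSectionVars false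

/-- The support of a word. -/
noncomputable def wordSupport (c : ι → F) : Finset ι :=
  open Classical in Finset.univ.filter fun i => c i ≠ 0

/-- The support of a code: the coordinates on which some codeword does not vanish. -/
noncomputable def codeSupport (A : Submodule F (ι → F)) : Finset ι :=
  open Classical in Finset.univ.filter fun i => ∃ c ∈ A, c i ≠ 0

@[simp] lemma mem_wordSupport {c : ι → F} {i : ι} : i ∈ wordSupport c ↔ c i ≠ 0 := by
  simp [wordSupport]

@[simp] lemma mem_codeSupport {A : Submodule F (ι → F)} {i : ι} :
    i ∈ codeSupport A ↔ ∃ c ∈ A, c i ≠ 0 := by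
  simp [codeSupport]

lemma wordSupport_subset_codeSupport {A : Submodule F (ι → F)} {c : ι → F} (hc : c ∈ A) :
    wordSupport c ⊆ codeSupport A :=
  fun _ hi => mem_codeSupport.2 ⟨c, hc, mem_wordSupport.1 hi⟩

lemma codeSupport_mono {A B : Submodule F (ι → F)} (h : A ≤ B) :
    codeSupport A ⊆ codeSupport B := by
  intro i hi
  obtain ⟨c, hc, hci⟩ := mem_codeSupport.1 hi
  exact mem_codeSupport.2 ⟨c, h hc, hci⟩

/-- Every subcode of dimension `d` has a support of size at least `κ * d`. -/
def IsStrongCode (κ : ℝ) (A : Submodule F (ι → F)) : Prop :=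
  ∀ U ≤ A, κ * Module.finrank F U ≤ (codeSupport U).card

lemma IsStrongCode.mono {κ : ℝ} {A B : Submodule F (ι → F)} (hB : IsStrongCode κ B)
    (h : A ≤ B) : IsStrongCode κ A :=
  fun U hU => hB U (hU.trans h)

/-- The subcode of the words vanishing at `e`. -/
def shortenedCode (A : Submodule F (ι → F)) (e : ι) : Submodule F (ι → F) :=
  A ⊓ LinearMap.ker (LinearMap.proj e : (ι → F) →ₗ[F] F)

lemma mem_shortenedCode {A : Submodule F (ι → F)} {e : ι} {c : ι → F} :
    c ∈ shortenedCode A e ↔ c ∈ A ∧ c e = 0 := by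
  simp [shortenedCode]

lemma shortenedCode_le (A : Submodule F (ι → F)) (e : ι) : shortenedCode A e ≤ A := inf_le_left

lemma finrank_shortenedCode_lt {A : Submodule F (ι → F)} {e : ι} (he : e ∈ codeSupport A) :
    Module.finrank F (shortenedCode A e) < Module.finrank F A := by
  apply Submodule.finrank_lt_finrank_of_lt
  refine lt_of_le_of_ne (shortenedCode_le A e) fun h => ?_
  obtain ⟨c, hc, hce⟩ := mem_codeSupport.1 he
  rw [← h] at hc
  exact hce (mem_shortenedCode.1 hc).2

/-- The supports of codewords of weight at most `s`. -/
noncomputable def lightSupports (A : Submodule F (ι → F)) (s : ℝ) : Finset (Finset ι) :=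
  open Classical in
  Finset.univ.filter fun Q => (∃ c ∈ A, wordSupport c = Q) ∧ (Q.card : ℝ) ≤ s

lemma mem_lightSupports {A : Submodule F (ι → F)} {s : ℝ} {Q : Finset ι} :
    Q ∈ lightSupports A s ↔ (∃ c ∈ A, wordSupport c = Q) ∧ (Q.card : ℝ) ≤ s := by
  simp [lightSupports]

lemma subset_of_mem_lightSupports {A : Submodule F (ι → F)} {s : ℝ} {Q : Finset ι}
    (hQ : Q ∈ lightSupports A s) : Q ⊆ codeSupport A := by
  obtain ⟨⟨c, hc, rfl⟩, -⟩ := mem_lightSupports.1 hQ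
  exact wordSupport_subset_codeSupport hc

lemma mem_lightSupports_shortenedCode {A : Submodule F (ι → F)} {s : ℝ} {Q : Finset ι} {e : ι}
    (hQ : Q ∈ lightSupports A s) (he : e ∉ Q) : Q ∈ lightSupports (shortenedCode A e) s := by
  obtain ⟨⟨c, hc, rfl⟩, hs⟩ := mem_lightSupports.1 hQ
  refine mem_lightSupports.2 ⟨⟨c, mem_shortenedCode.2 ⟨hc, ?_⟩, rfl⟩, hs⟩
  simpa using he

/-- A support is either the whole `codeSupport A` or misses some coordinate `e`, and then it already
occurs in the shortened code, of smaller dimension. The field size never enters. -/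
lemma card_lightSupports_le_pow (s : ℝ) {μ : ℕ} (r : ℕ) :
    ∀ A : Submodule F (ι → F), (codeSupport A).card + 1 ≤ μ → Module.finrank F A ≤ r →
      (lightSupports A s).card ≤ μ ^ r := by
  classical
  induction r with
  | zero =>
    intro A _ hr
    have hA : A = ⊥ := Submodule.finrank_eq_zero.1 (Nat.le_zero.1 hr)
    rw [pow_zero, Finset.card_le_one]
    intro Q hQ Q' hQ'
    have key : ∀ P ∈ lightSupports A s, P = ∅ := fun P hP => by
      have := subset_of_mem_lightSupports hP
      refine Finset.subset_empty.1 (this.trans ?_)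
      intro i hi
      obtain ⟨c, hc, hci⟩ := mem_codeSupport.1 hi
      rw [hA, Submodule.mem_bot] at hc
      simp [hc] at hci
    rw [key Q hQ, key Q' hQ']
  | succ r ih =>
    intro A hμ hr
    have hsub : lightSupports A s ⊆ {codeSupport A} ∪
        (codeSupport A).biUnion fun e => lightSupports (shortenedCode A e) s := by
      intro Q hQ
      by_cases h : Q = codeSupport A
      · simp [h]
      · have hss : Q ⊂ codeSupport A :=
          lt_of_le_of_ne (subset_of_mem_lightSupports hQ) h
        obtain ⟨e, he, heQ⟩ := Finset.exists_of_ssubset hss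
        exact Finset.mem_union_right _
          (Finset.mem_biUnion.2 ⟨e, he, mem_lightSupports_shortenedCode hQ heQ⟩)
    have hpos : 1 ≤ μ ^ r := Nat.one_le_pow _ _ (by omega)
    calc (lightSupports A s).card
        ≤ 1 + (codeSupport A).card * μ ^ r := by
          refine (Finset.card_le_card hsub).trans ((Finset.card_union_le _ _).trans ?_)
          refine Nat.add_le_add (by simp) ?_
          refine Finset.card_biUnion_le_card_mul _ _ _ fun e he => ih _ ?_ ?_
          · exact le_trans (Nat.add_le_add_right
              (Finset.card_le_card (codeSupport_mono (shortenedCode_le A e))) 1) hμ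
          · have := finrank_shortenedCode_lt he
            omega
      _ ≤ ((codeSupport A).card + 1) * μ ^ r := by nlinarith
      _ ≤ μ ^ (r + 1) := by
          rw [pow_succ, mul_comm]
          exact Nat.mul_le_mul_left _ hμ

/-- Double counting of the pairs of a light support and a coordinate of `codeSupport A` that it
misses. -/
lemma card_lightSupports_mul_le {A : Submodule F (ι → F)} {s : ℝ} {N : ℕ}
    (hN : ∀ e ∈ codeSupport A, (lightSupports (shortenedCode A e) s).card ≤ N) :
    (lightSupports A s).card * ((codeSupport A).card - s) ≤ (codeSupport A).card * (N : ℝ) := by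
  classical
  have h1 : ∑ Q ∈ lightSupports A s, ((codeSupport A \ Q).card : ℝ) =
      ∑ e ∈ codeSupport A, (((lightSupports A s).filter fun Q => e ∉ Q).card : ℝ) := by
    simp_rw [Finset.card_filter, ← Finset.filter_notMem_eq_sdiff, Finset.card_filter]
    push_cast
    exact Finset.sum_comm
  have h2 : (lightSupports A s).card * ((codeSupport A).card - s) ≤
      ∑ Q ∈ lightSupports A s, ((codeSupport A \ Q).card : ℝ) := by
    rw [← nsmul_eq_mul]
    refine Finset.card_nsmul_le_sum _ _ _ fun Q hQ => ?_
    rw [Finset.card_sdiff_of_subset (subset_of_mem_lightSupports hQ),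
      Nat.cast_sub (Finset.card_le_card (subset_of_mem_lightSupports hQ))]
    linarith [(mem_lightSupports.1 hQ).2]
  refine h2.trans (h1.le.trans ?_)
  rw [← nsmul_eq_mul]
  refine Finset.sum_le_card_nsmul _ _ _ fun e he => ?_
  refine Nat.cast_le.2 (le_trans (Finset.card_le_card fun Q hQ => ?_) (hN e he))
  obtain ⟨hQ, heQ⟩ := Finset.mem_filter.1 hQ
  exact mem_lightSupports_shortenedCode hQ heQ

/-- The contraction argument. In dimension `r` strength gives at least `κ * r` coordinates, so a
light support misses at least a fraction `(r - a) / r` of them, and shortening costs a factor `r /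
(r - a)`. This is the recursion of `r.choose a`; it stops at dimension `2 * a`, where the crude
power bound takes over. -/
lemma card_lightSupports_le_choose {κ : ℝ} (hκ : 0 < κ) (a : ℕ) {μ : ℕ} (k : ℕ) :
    ∀ A : Submodule F (ι → F), (codeSupport A).card + 1 ≤ μ → IsStrongCode κ A →
      Module.finrank F A ≤ 2 * a + k →
      (lightSupports A (a * κ)).card ≤ (2 * a + k).choose a * μ ^ (2 * a) := by
  induction k with
  | zero =>
    intro A hμ _ hr
    refine (card_lightSupports_le_pow _ _ A hμ hr).trans ?_
    exact Nat.le_mul_of_pos_left _ (Nat.choose_pos (by omega))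
  | succ k ih =>
    intro A hμ hA hr
    rcases Nat.lt_or_ge (Module.finrank F A) (2 * a + (k + 1)) with hlt | hge
    · refine (ih A hμ hA (by omega)).trans (Nat.mul_le_mul_right _ ?_)
      exact Nat.choose_le_choose a (by omega)
    have hr' : Module.finrank F A = 2 * a + k + 1 := by omega
    have hN : ∀ e ∈ codeSupport A, (lightSupports (shortenedCode A e) (a * κ)).card ≤
        (2 * a + k).choose a * μ ^ (2 * a) := fun e he => by
      refine ih _ ?_ (hA.mono (shortenedCode_le A e)) ?_
      · exact le_trans (Nat.add_le_add_right
          (Finset.card_le_card (codeSupport_mono (shortenedCode_le A e))) 1) hμ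
      · have := finrank_shortenedCode_lt he
        omega
    have h1 := card_lightSupports_mul_le hN
    have h2 := hA A le_rfl
    rw [hr'] at h2
    have hch : ((2 * a + k).choose a : ℝ) * (2 * a + k + 1) =
        (2 * a + (k + 1)).choose a * (a + k + 1) := by
      have := Nat.choose_mul_succ_eq (2 * a + k) a
      rw [show 2 * a + k + 1 - a = a + k + 1 by omega] at this
      exact_mod_cast this
    push_cast at h1 h2
    rw [← Nat.cast_le (α := ℝ)]
    push_cast
    set N : ℝ := ((lightSupports A ((a : ℝ) * κ)).card : ℝ)
    set M : ℝ := ((codeSupport A).card : ℝ)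
    set p : ℝ := (μ : ℝ) ^ (2 * a)
    set b : ℝ := ((2 * a + k).choose a : ℝ)
    set b' : ℝ := ((2 * a + (k + 1)).choose a : ℝ)
    have hN0 : 0 ≤ N := Nat.cast_nonneg _
    have ha0 : (0 : ℝ) ≤ a := Nat.cast_nonneg _
    have hk0 : (0 : ℝ) ≤ k := Nat.cast_nonneg _
    have hM : 0 < M := lt_of_lt_of_le (by positivity) h2
    have hpos : 0 < M * (a + k + 1) := by positivity
    refine le_of_mul_le_mul_left ?_ hpos
    have h3 : M * (a + k + 1) ≤ (M - a * κ) * (2 * a + k + 1) := by nlinarith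
    calc M * (a + k + 1) * N ≤ (M - a * κ) * (2 * a + k + 1) * N :=
          mul_le_mul_of_nonneg_right h3 hN0
      _ = (N * (M - a * κ)) * (2 * a + k + 1) := by ring
      _ ≤ (M * (b * p)) * (2 * a + k + 1) := mul_le_mul_of_nonneg_right h1 (by positivity)
      _ = M * p * (b * (2 * a + k + 1)) := by ring
      _ = M * (a + k + 1) * (b' * p) := by rw [hch]; ring

/-- A strong code has few supports of light codewords. -/
lemma IsStrongCode.card_lightSupports_le {κ : ℝ} (hκ : 0 < κ) {A : Submodule F (ι → F)}
    (hA : IsStrongCode κ A) (a : ℕ) {μ : ℕ} (hμ : (codeSupport A).card + 1 ≤ μ)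
    (hr : Module.finrank F A ≤ μ) :
    (lightSupports A (a * κ)).card ≤ μ ^ (3 * a) := by
  have hμ1 : 1 ≤ μ := by omega
  rcases Nat.le_total (Module.finrank F A) (2 * a) with h | h
  · exact (card_lightSupports_le_pow _ _ A hμ h).trans (Nat.pow_le_pow_right hμ1 (by omega))
  · obtain ⟨k, hk⟩ := Nat.exists_eq_add_of_le h
    refine (card_lightSupports_le_choose hκ a k A hμ hA hk.le).trans ?_
    rw [← hk, show 3 * a = a + 2 * a by ring, pow_add]
    exact Nat.mul_le_mul_right _ ((Nat.choose_le_pow _ _).trans (Nat.pow_le_pow_left hr _))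

lemma finrank_le_card_codeSupport (A : Submodule F (ι → F)) :
    Module.finrank F A ≤ (codeSupport A).card := by
  let f : A →ₗ[F] (codeSupport A → F) :=
    LinearMap.pi fun i => (LinearMap.proj (i : ι)).comp A.subtype
  have hf : Function.Injective f := by
    refine (injective_iff_map_eq_zero f).2 fun c hc => ?_
    ext i
    by_contra hi
    have h := congrFun hc ⟨i, mem_codeSupport.2 ⟨c, c.2, hi⟩⟩
    exact hi h
  simpa using LinearMap.finrank_le_finrank_of_injective hf

end Codes

/-! ### Puncturing and strong cores. -/

section Cores

variable {ι F : Type*} [Fintype ι] [Field F]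

set_option linter.unusedSectionVars false

/-- The projection that replaces the coordinates outside `S` by zero. -/
noncomputable def restrictTo (F : Type*) [Field F] (S : Finset ι) : (ι → F) →ₗ[F] (ι → F) :=
  open Classical in LinearMap.pi fun i => if i ∈ S then LinearMap.proj i else 0

lemma restrictTo_apply_of_mem {S : Finset ι} {i : ι} (hi : i ∈ S) (c : ι → F) :
    restrictTo F S c i = c i := by
  simp [restrictTo, hi]

lemma restrictTo_apply_of_notMem {S : Finset ι} {i : ι} (hi : i ∉ S) (c : ι → F) :
    restrictTo F S c i = 0 := by
  simp [restrictTo, hi]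

lemma restrictTo_restrictTo_of_subset {S T : Finset ι} (h : S ⊆ T) (c : ι → F) :
    restrictTo F S (restrictTo F T c) = restrictTo F S c := by
  ext i
  by_cases hi : i ∈ S
  · rw [restrictTo_apply_of_mem hi, restrictTo_apply_of_mem hi, restrictTo_apply_of_mem (h hi)]
  · rw [restrictTo_apply_of_notMem hi, restrictTo_apply_of_notMem hi]

/-- The punctured code: the coordinates outside `S` are replaced by zero. -/
noncomputable def puncturedCode (C : Submodule F (ι → F)) (S : Finset ι) :
    Submodule F (ι → F) :=
  C.map (restrictTo F S)

lemma puncturedCode_puncturedCode_of_subset (C : Submodule F (ι → F)) {S T : Finset ι}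
    (h : S ⊆ T) : puncturedCode (puncturedCode C T) S = puncturedCode C S := by
  rw [puncturedCode, puncturedCode, puncturedCode, ← Submodule.map_comp]
  congr 1
  ext1 c
  exact restrictTo_restrictTo_of_subset h c

lemma codeSupport_puncturedCode_subset (C : Submodule F (ι → F)) (S : Finset ι) :
    codeSupport (puncturedCode C S) ⊆ S := by
  intro i hi
  obtain ⟨_, ⟨c, -, rfl⟩, hi⟩ := mem_codeSupport.1 hi
  by_contra hS
  exact hi (restrictTo_apply_of_notMem hS c)

lemma codeSupport_puncturedCode (C : Submodule F (ι → F)) [DecidableEq ι] (S : Finset ι) :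
    codeSupport (puncturedCode C S) = codeSupport C ∩ S := by
  ext i
  rw [Finset.mem_inter]
  constructor
  · intro hi
    have hS := codeSupport_puncturedCode_subset C S hi
    obtain ⟨_, ⟨c, hc, rfl⟩, hi⟩ := mem_codeSupport.1 hi
    rw [restrictTo_apply_of_mem hS] at hi
    exact ⟨mem_codeSupport.2 ⟨c, hc, hi⟩, hS⟩
  · rintro ⟨hi, hS⟩
    obtain ⟨c, hc, hi⟩ := mem_codeSupport.1 hi
    refine mem_codeSupport.2 ⟨_, ⟨c, hc, rfl⟩, ?_⟩
    rwa [restrictTo_apply_of_mem hS]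

lemma wordSupport_restrictTo [DecidableEq ι] (S : Finset ι) (c : ι → F) :
    wordSupport (restrictTo F S c) = wordSupport c ∩ S := by
  ext i
  by_cases hi : i ∈ S
  · simp [restrictTo_apply_of_mem hi, hi]
  · simp [restrictTo_apply_of_notMem hi, hi]

lemma finrank_puncturedCode_add_finrank_inf_ker (U : Submodule F (ι → F)) (S : Finset ι) :
    Module.finrank F (puncturedCode U S) +
      Module.finrank F (U ⊓ LinearMap.ker (restrictTo F S) : Submodule F (ι → F)) =
      Module.finrank F U := by
  have h := LinearMap.finrank_range_add_finrank_ker ((restrictTo F S).domRestrict U)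
  rw [LinearMap.range_domRestrict] at h
  have h2 : Module.finrank F (LinearMap.ker ((restrictTo F S).domRestrict U)) =
      Module.finrank F (U ⊓ LinearMap.ker (restrictTo F S) : Submodule F (ι → F)) := by
    rw [LinearMap.ker_domRestrict, ← Submodule.map_comap_subtype]
    exact (LinearEquiv.finrank_eq
      (Submodule.equivMapOfInjective _ U.injective_subtype _))
  rw [← h2]
  exact h

/-- A subcode `U` splits into its restriction to `S` and its words vanishing on `S`. Dimensions add
up, the supports are disjoint, and the second piece lives on `T`, so the two strength bounds add. -/
lemma isStrongCode_puncturedCode_union [DecidableEq ι] {κ : ℝ} {C : Submodule F (ι → F)}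
    {S T : Finset ι}
    (hS : IsStrongCode κ (puncturedCode C S)) (hT : IsStrongCode κ (puncturedCode C T)) :
    IsStrongCode κ (puncturedCode C (S ∪ T)) := by
  intro U hU
  set V : Submodule F (ι → F) := U ⊓ LinearMap.ker (restrictTo F S) with hV
  have hVT : V ≤ puncturedCode C T := by
    rintro v ⟨hvU, hvS⟩
    obtain ⟨c, hc, rfl⟩ := hU hvU
    refine ⟨c, hc, ?_⟩
    ext i
    by_cases hi : i ∈ T
    · rw [restrictTo_apply_of_mem hi, restrictTo_apply_of_mem (Finset.mem_union_right _ hi)]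
    · rw [restrictTo_apply_of_notMem hi]
      by_cases hiS : i ∈ S
      · have := congrFun (LinearMap.mem_ker.1 hvS) i
        rw [restrictTo_apply_of_mem hiS] at this
        exact this.symm
      · rw [restrictTo_apply_of_notMem (by simp [hi, hiS])]
  have hUS : puncturedCode U S ≤ puncturedCode C S := by
    rw [← puncturedCode_puncturedCode_of_subset C (Finset.subset_union_left (s₂ := T))]
    exact Submodule.map_mono hU
  have h1 := hS _ hUS
  have h2 := hT _ hVT
  have h3 := finrank_puncturedCode_add_finrank_inf_ker U S
  rw [← hV] at h3
  have h4 : (codeSupport (puncturedCode U S)).card + (codeSupport V).card ≤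
      (codeSupport U).card := by
    rw [← Finset.card_union_of_disjoint]
    · refine Finset.card_le_card (Finset.union_subset ?_ (codeSupport_mono inf_le_left))
      rw [codeSupport_puncturedCode]
      exact Finset.inter_subset_left
    · refine Finset.disjoint_left.2 fun i hi hi' => ?_
      have hiS := codeSupport_puncturedCode_subset U S hi
      obtain ⟨v, hv, hvi⟩ := mem_codeSupport.1 hi'
      have := congrFun (LinearMap.mem_ker.1 hv.2) i
      rw [restrictTo_apply_of_mem hiS] at this
      exact hvi this
  rw [← Nat.cast_le (α := ℝ)] at h4
  rw [← h3]
  push_cast at h4 ⊢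
  linarith

lemma isStrongCode_puncturedCode_empty (κ : ℝ) (C : Submodule F (ι → F)) :
    IsStrongCode κ (puncturedCode C ∅) := by
  intro U hU
  have : U = ⊥ := by
    refine (Submodule.eq_bot_iff _).2 fun u hu => ?_
    obtain ⟨c, -, rfl⟩ := hU hu
    ext i
    exact restrictTo_apply_of_notMem (by simp) c
  subst this
  simp

/-- The largest subset of `E` on which the code is strong. -/
noncomputable def strongCore (κ : ℝ) (C : Submodule F (ι → F)) (E : Finset ι) : Finset ι :=
  open Classical in
  (E.powerset.filter fun S => IsStrongCode κ (puncturedCode C S)).sup id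

lemma strongCore_subset (κ : ℝ) (C : Submodule F (ι → F)) (E : Finset ι) :
    strongCore κ C E ⊆ E := by
  classical
  refine Finset.sup_le fun S hS => ?_
  exact Finset.mem_powerset.1 (Finset.mem_filter.1 hS).1

lemma isStrongCode_strongCore (κ : ℝ) (C : Submodule F (ι → F)) (E : Finset ι) :
    IsStrongCode κ (puncturedCode C (strongCore κ C E)) := by
  classical
  refine Finset.sup_induction (p := fun S => IsStrongCode κ (puncturedCode C S))
    (isStrongCode_puncturedCode_empty κ C)
    (fun S hS T hT => isStrongCode_puncturedCode_union hS hT) fun S hS => ?_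
  exact (Finset.mem_filter.1 hS).2

lemma subset_strongCore {κ : ℝ} {C : Submodule F (ι → F)} {S E : Finset ι} (h : S ⊆ E)
    (hS : IsStrongCode κ (puncturedCode C S)) : S ⊆ strongCore κ C E := by
  classical
  exact Finset.le_sup (f := id) (Finset.mem_filter.2 ⟨Finset.mem_powerset.2 h, hS⟩)

lemma strongCore_mono (κ : ℝ) (C : Submodule F (ι → F)) {E E' : Finset ι} (h : E ⊆ E') :
    strongCore κ C E ⊆ strongCore κ C E' :=
  subset_strongCore ((strongCore_subset κ C E).trans h) (isStrongCode_strongCore κ C E)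

/-- A set without nonempty strong subsets is small. -/
lemma card_le_of_forall_not_isStrongCode {κ : ℝ} (hκ : 0 ≤ κ) (C : Submodule F (ι → F)) :
    ∀ K : Finset ι,
      (∀ S ⊆ K, IsStrongCode κ (puncturedCode C S) → S = ∅) →
      (K.card : ℝ) ≤ κ * Module.finrank F (puncturedCode C K) := by
  classical
  intro K
  induction K using Finset.strongInduction with
  | H K ih =>
    intro hK
    by_cases hs : IsStrongCode κ (puncturedCode C K)
    · rw [hK K subset_rfl hs]
      simp only [Finset.card_empty, Nat.cast_zero]
      positivity
    unfold IsStrongCode at hs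
    push Not at hs
    -- `U` witnesses that `K` is not strong. Removing its support deletes fewer than `κ * dim U`
    -- coordinates and lowers the dimension by at least `dim U`, since `U` is killed by the
    -- restriction.
    obtain ⟨U, hU, hlt⟩ := hs
    have hUK : codeSupport U ⊆ K :=
      (codeSupport_mono hU).trans (codeSupport_puncturedCode_subset C K)
    have hne : (codeSupport U).Nonempty := by
      by_contra hne
      rw [Finset.not_nonempty_iff_eq_empty] at hne
      have h0 := finrank_le_card_codeSupport U
      rw [hne, Finset.card_empty, Nat.le_zero] at h0
      simp [hne, h0] at hlt
    have hss : K \ codeSupport U ⊂ K := Finset.sdiff_ssubset hUK hne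
    have h1 := ih _ hss fun S hS => hK S (hS.trans hss.subset)
    have h2 := finrank_puncturedCode_add_finrank_inf_ker (puncturedCode C K) (K \ codeSupport U)
    rw [puncturedCode_puncturedCode_of_subset C hss.subset] at h2
    have h3 : Module.finrank F U ≤ Module.finrank F (puncturedCode C K ⊓
        LinearMap.ker (restrictTo F (K \ codeSupport U)) : Submodule F (ι → F)) := by
      refine Submodule.finrank_mono (le_inf hU fun u hu => LinearMap.mem_ker.2 ?_)
      ext i
      by_cases hi : i ∈ K \ codeSupport U
      · rw [restrictTo_apply_of_mem hi]
        by_contra hne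
        exact (Finset.mem_sdiff.1 hi).2 (mem_codeSupport.2 ⟨u, hu, hne⟩)
      · rw [restrictTo_apply_of_notMem hi, Pi.zero_apply]
    have h4 : (Module.finrank F (puncturedCode C (K \ codeSupport U)) : ℝ) +
        Module.finrank F U ≤ Module.finrank F (puncturedCode C K) := by
      rw [← h2]
      exact_mod_cast Nat.add_le_add_left h3 _
    have h5 : (K.card : ℝ) = (K \ codeSupport U).card + (codeSupport U).card := by
      exact_mod_cast (Finset.card_sdiff_add_card_eq_card hUK).symm
    nlinarith

lemma finrank_puncturedCode_le (C : Submodule F (ι → F)) (S : Finset ι) :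
    Module.finrank F (puncturedCode C S) ≤ Module.finrank F C :=
  Submodule.finrank_map_le _ _

end Cores

/-! ### Random signs and summation by parts. -/

section Signs

variable {ι : Type*}

/-- The sign of a Boolean: `1` for `true` and `-1` for `false`. -/
def boolSign (b : Bool) : ℝ := if b then 1 else -1

lemma boolSign_not (b : Bool) : boolSign (!b) = -boolSign b := by
  cases b <;> simp [boolSign]

lemma sum_exp_mul_sum_boolSign_le [Fintype ι] [DecidableEq ι] (t : ℝ) (T : Finset ι) :
    ∑ X : ι → Bool, Real.exp (t * ∑ i ∈ T, boolSign (X i)) ≤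
      2 ^ Fintype.card ι * Real.exp (t ^ 2 / 2 * T.card) := by
  have h1 : ∀ X : ι → Bool, Real.exp (t * ∑ i ∈ T, boolSign (X i)) =
      ∏ i, (if i ∈ T then Real.exp (t * boolSign (X i)) else 1) := fun X => by
    rw [Finset.mul_sum, Real.exp_sum, Finset.prod_ite_mem, Finset.univ_inter]
  simp_rw [h1]
  have h2 := Finset.prod_univ_sum (fun _ : ι => (Finset.univ : Finset Bool))
    (fun i b => if i ∈ T then Real.exp (t * boolSign b) else 1)
  rw [Fintype.piFinset_univ] at h2
  rw [← h2]
  have h3 : ∀ i : ι, ∑ b : Bool, (if i ∈ T then Real.exp (t * boolSign b) else 1) =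
      2 * (if i ∈ T then Real.cosh t else 1) := fun i => by
    by_cases hi : i ∈ T
    · simp [hi, boolSign, Real.cosh_eq]
      ring
    · simp [hi]
  simp_rw [h3]
  rw [Finset.prod_mul_distrib, Finset.prod_const, Finset.prod_ite_mem, Finset.univ_inter,
    Finset.prod_const, Finset.card_univ, mul_comm (t ^ 2 / 2), Real.exp_nat_mul]
  gcongr
  exact Real.cosh_le_exp_half_sq t

/-- Signs with small discrepancy on a family of sets, by the exponential moment method. -/
lemma exists_boolSign_sum_le [Fintype ι] {α : Type*} (J : Finset α) (T Q : α → Finset ι)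
    (hTQ : ∀ j ∈ J, T j ⊆ Q j) {η : ℝ} (hη : 0 < η)
    (hJ : ∑ j ∈ J, 2 * Real.exp (-(η ^ 2 / 2 * (Q j).card)) < 1) :
    ∃ X : ι → Bool, ∀ j ∈ J, |∑ i ∈ T j, boolSign (X i)| ≤ η * (Q j).card := by
  classical
  by_contra! hX
  -- Markov with exponential parameter `η`: a violated `j` contributes at least `1`, while its
  -- average is at most `2 * exp (-(η ^ 2 / 2 * |Q j|))`.
  have h1 : ∀ X : ι → Bool, 1 ≤ ∑ j ∈ J, (Real.exp (η * ∑ i ∈ T j, boolSign (X i)) +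
      Real.exp (-η * ∑ i ∈ T j, boolSign (X i))) * Real.exp (-(η ^ 2 * (Q j).card)) := by
    intro X
    obtain ⟨j, hj, hlt⟩ := hX X
    refine le_trans ?_ (Finset.single_le_sum (fun j _ => by positivity) hj)
    rw [add_mul, ← Real.exp_add, ← Real.exp_add]
    rcases lt_abs.1 hlt with h | h
    · refine le_add_of_le_of_nonneg (Real.one_le_exp ?_) (Real.exp_nonneg _)
      nlinarith
    · refine le_add_of_nonneg_of_le (Real.exp_nonneg _) (Real.one_le_exp ?_)
      nlinarith
  have h2 : (2 : ℝ) ^ Fintype.card ι ≤ ∑ X : ι → Bool, ∑ j ∈ J,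
      (Real.exp (η * ∑ i ∈ T j, boolSign (X i)) +
        Real.exp (-η * ∑ i ∈ T j, boolSign (X i))) * Real.exp (-(η ^ 2 * (Q j).card)) := by
    have := Finset.card_nsmul_le_sum (Finset.univ : Finset (ι → Bool)) _ 1 fun X _ => h1 X
    simpa using this
  rw [Finset.sum_comm] at h2
  have h3 : ∀ j ∈ J, ∑ X : ι → Bool, (Real.exp (η * ∑ i ∈ T j, boolSign (X i)) +
        Real.exp (-η * ∑ i ∈ T j, boolSign (X i))) * Real.exp (-(η ^ 2 * (Q j).card)) ≤
      2 ^ Fintype.card ι * (2 * Real.exp (-(η ^ 2 / 2 * (Q j).card))) := by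
    intro j hj
    have hc : ((T j).card : ℝ) ≤ (Q j).card := Nat.cast_le.2 (Finset.card_le_card (hTQ j hj))
    have e1 := sum_exp_mul_sum_boolSign_le η (T j)
    have e2 := sum_exp_mul_sum_boolSign_le (-η) (T j)
    rw [neg_sq] at e2
    have e3 : Real.exp (η ^ 2 / 2 * (T j).card) ≤ Real.exp (η ^ 2 / 2 * (Q j).card) :=
      Real.exp_le_exp.2 (mul_le_mul_of_nonneg_left hc (by positivity))
    rw [← Finset.sum_mul, Finset.sum_add_distrib]
    calc _ ≤ (2 * (2 ^ Fintype.card ι * Real.exp (η ^ 2 / 2 * (Q j).card))) *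
          Real.exp (-(η ^ 2 * (Q j).card)) := by
          refine mul_le_mul_of_nonneg_right ?_ (Real.exp_nonneg _)
          have : (2 : ℝ) ^ Fintype.card ι * Real.exp (η ^ 2 / 2 * (T j).card) ≤
            2 ^ Fintype.card ι * Real.exp (η ^ 2 / 2 * (Q j).card) :=
              mul_le_mul_of_nonneg_left e3 (by positivity)
          linarith
      _ = 2 ^ Fintype.card ι * (2 * (Real.exp (η ^ 2 / 2 * (Q j).card) *
          Real.exp (-(η ^ 2 * (Q j).card)))) := by ring
      _ = _ := by
          rw [← Real.exp_add]
          congr 3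
          ring
  have h4 := h2.trans (Finset.sum_le_sum h3)
  rw [← Finset.mul_sum] at h4
  have h5 : (0 : ℝ) < 2 ^ Fintype.card ι := by positivity
  nlinarith

/-- The signs can moreover be chosen such that at most half of a given set is positive. -/
lemma exists_boolSign_sum_le_and_card_le [Fintype ι] {α : Type*} (J : Finset α)
    (T Q : α → Finset ι) (hTQ : ∀ j ∈ J, T j ⊆ Q j) {η : ℝ} (hη : 0 < η)
    (hJ : ∑ j ∈ J, 2 * Real.exp (-(η ^ 2 / 2 * (Q j).card)) < 1) (R : Finset ι) :
    ∃ X : ι → Bool, (∀ j ∈ J, |∑ i ∈ T j, boolSign (X i)| ≤ η * (Q j).card) ∧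
      2 * (R.filter fun i => X i = true).card ≤ R.card := by
  obtain ⟨X, hX⟩ := exists_boolSign_sum_le J T Q hTQ hη hJ
  have hcard := Finset.card_filter_add_card_filter_not (s := R) (fun i => X i = true)
  by_cases h : 2 * (R.filter fun i => X i = true).card ≤ R.card
  · exact ⟨X, hX, h⟩
  · refine ⟨fun i => !X i, fun j hj => ?_, ?_⟩
    · simp_rw [boolSign_not, Finset.sum_neg_distrib, abs_neg]
      exact hX j hj
    · have : (R.filter fun i => (!X i) = true) = R.filter fun i => ¬ X i = true := by
        ext i; simp
      rw [this]
      omega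

/-- Summation by parts: a weighted sum is nonnegative if all its superlevel sums are. -/
lemma sum_mul_nonneg_of_superlevel_nonneg (h : ι → ℝ) (s : Finset ι) :
    ∀ W : ι → ℝ, (∀ i ∈ s, 0 ≤ W i) →
      (∀ i ∈ s, 0 < W i → 0 ≤ ∑ j ∈ s.filter (fun j => W i ≤ W j), h j) →
      0 ≤ ∑ i ∈ s, W i * h i := by
  classical
  induction s using Finset.strongInduction with
  | H s ih =>
    intro W hW hlev
    rcases s.eq_empty_or_nonempty with rfl | hne
    · simp
    obtain ⟨a, ha, hmin⟩ := Finset.exists_min_image s W hne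
    have hss : s.filter (fun j => W a < W j) ⊂ s :=
      Finset.filter_ssubset.2 ⟨a, ha, lt_irrefl _⟩
    -- Subtracting the minimal weight kills the lightest elements and leaves the superlevel sets
    -- above it unchanged.
    have h1 := ih _ hss (fun i => W i - W a)
      (fun i hi => by linarith [(Finset.mem_filter.1 hi).2]) fun i hi _ => by
        obtain ⟨his, hai⟩ := Finset.mem_filter.1 hi
        have := hlev i his (lt_of_le_of_lt (hW a ha) hai)
        convert this using 2
        ext j
        simp only [Finset.mem_filter]
        constructor
        · rintro ⟨⟨hj, -⟩, hij⟩
          exact ⟨hj, by linarith⟩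
        · rintro ⟨hj, hij⟩
          exact ⟨⟨hj, by linarith⟩, by linarith⟩
    have h2 : ∑ i ∈ s.filter (fun j => W a < W j), (W i - W a) * h i =
        ∑ i ∈ s, (W i - W a) * h i := by
      refine Finset.sum_filter_of_ne fun i hi hne => ?_
      refine lt_of_le_of_ne (hmin i hi) fun heq => hne ?_
      rw [heq, sub_self, zero_mul]
    have h3 : 0 ≤ W a * ∑ i ∈ s, h i := by
      rcases (hW a ha).eq_or_lt with h0 | h0
      · rw [← h0, zero_mul]
      · have := hlev a ha h0
        rw [Finset.filter_true_of_mem hmin] at this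
        exact mul_nonneg h0.le this
    have h4 : ∑ i ∈ s, W i * h i = ∑ i ∈ s, (W i - W a) * h i + W a * ∑ i ∈ s, h i := by
      rw [Finset.mul_sum, ← Finset.sum_add_distrib]
      exact Finset.sum_congr rfl fun i _ => by ring
    rw [h4]
    linarith

end Signs

/-! ### The union bound over all supports of a strong code. -/

section Potential

variable {ι F : Type*} [Fintype ι] [Field F]

/-- The supports of the nonzero codewords. -/
noncomputable def nonzeroSupports (A : Submodule F (ι → F)) : Finset (Finset ι) :=
  open Classical in Finset.univ.filter fun Q => Q.Nonempty ∧ ∃ c ∈ A, wordSupport c = Q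

lemma mem_nonzeroSupports {A : Submodule F (ι → F)} {Q : Finset ι} :
    Q ∈ nonzeroSupports A ↔ Q.Nonempty ∧ ∃ c ∈ A, wordSupport c = Q := by
  simp [nonzeroSupports]

lemma IsStrongCode.le_card_of_mem_nonzeroSupports {κ : ℝ} {A : Submodule F (ι → F)}
    (hA : IsStrongCode κ A) {Q : Finset ι} (hQ : Q ∈ nonzeroSupports A) : κ ≤ Q.card := by
  obtain ⟨hne, c, hc, rfl⟩ := mem_nonzeroSupports.1 hQ
  have hc0 : c ≠ 0 := by
    rintro rfl
    obtain ⟨i, hi⟩ := hne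
    simp at hi
  have h := hA (Submodule.span F {c}) (by simpa using hc)
  rw [finrank_span_singleton hc0, Nat.cast_one, mul_one] at h
  refine h.trans (Nat.cast_le.2 (Finset.card_le_card fun i hi => ?_))
  obtain ⟨v, hv, hvi⟩ := mem_codeSupport.1 hi
  obtain ⟨r, rfl⟩ := Submodule.mem_span_singleton.1 hv
  rw [mem_wordSupport]
  rintro h0
  simp [h0] at hvi

/-- Supports are grouped by size in units of `κ`. Class `k` has at most `μ ^ (3 * k)` members and
each term is at most `2 * μ ^ (-6 * k)`; the constant `24` is chosen for this exponent. The bound `1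
/ μ` leaves room for a further union over fewer than `μ` weight levels. -/
lemma IsStrongCode.sum_exp_le {η : ℝ} (hη : 0 < η) (hη1 : η ≤ 1) {μ : ℕ} (hμ : 2 ≤ μ)
    {A : Submodule F (ι → F)} (hA : IsStrongCode (24 * Real.log μ / η ^ 2) A)
    (hcard : (codeSupport A).card + 1 ≤ μ) :
    ∑ Q ∈ nonzeroSupports A, 2 * Real.exp (-(η ^ 2 / 2 * Q.card)) < 1 / μ := by
  classical
  set κ : ℝ := 24 * Real.log μ / η ^ 2 with hκdef
  have hμR : (2 : ℝ) ≤ μ := by exact_mod_cast hμ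
  have hμ0 : (0 : ℝ) < μ := by linarith
  have hlog : (1 / 2 : ℝ) ≤ Real.log μ := by
    have := Real.log_le_log (by norm_num) hμR
    linarith [Real.log_two_gt_d9]
  have hη2 : η ^ 2 ≤ 1 := pow_le_one₀ hη.le hη1
  have hηκ : η ^ 2 * κ = 24 * Real.log μ := by
    rw [hκdef]; field_simp
  have hκ1 : 1 ≤ κ := by
    rw [hκdef, le_div_iff₀ (by positivity)]
    linarith
  have hκ0 : 0 < κ := by linarith
  -- Nonzero words of a strong code have weight at least `κ`, so the class is at least `2` and `k -
  -- 1 ≥ k / 2` below.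
  let a : Finset ι → ℕ := fun Q => ⌊(Q.card : ℝ) / κ⌋₊ + 1
  have hmaps : ∀ Q ∈ nonzeroSupports A, a Q ∈ Finset.Icc 2 μ := by
    intro Q hQ
    obtain ⟨hne, c, hc, rfl⟩ := mem_nonzeroSupports.1 hQ
    have h1 := hA.le_card_of_mem_nonzeroSupports hQ
    have h2 : 1 ≤ ⌊((wordSupport c).card : ℝ) / κ⌋₊ :=
      (Nat.one_le_floor_iff _).2 ((one_le_div hκ0).2 h1)
    have h3 : ⌊((wordSupport c).card : ℝ) / κ⌋₊ ≤ (wordSupport c).card :=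
      Nat.floor_le_of_le (div_le_self (Nat.cast_nonneg _) hκ1)
    have h4 := Finset.card_le_card (wordSupport_subset_codeSupport hc)
    exact Finset.mem_Icc.2 ⟨Nat.add_le_add_right h2 1, by simp only [a]; omega⟩
  rw [← Finset.sum_fiberwise_of_maps_to hmaps]
  have hfib : ∀ k ∈ Finset.Icc 2 μ, ∑ Q ∈ (nonzeroSupports A).filter (fun Q => a Q = k),
      2 * Real.exp (-(η ^ 2 / 2 * Q.card)) ≤ 2 * ((μ : ℝ) ^ 6)⁻¹ := by
    intro k hk
    have hk2 : 2 ≤ k := (Finset.mem_Icc.1 hk).1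
    have hkR : (2 : ℝ) ≤ k := by exact_mod_cast hk2
    have hterm : ∀ Q ∈ (nonzeroSupports A).filter (fun Q => a Q = k),
        2 * Real.exp (-(η ^ 2 / 2 * Q.card)) ≤ 2 * ((μ : ℝ) ^ (6 * k))⁻¹ := by
      intro Q hQ
      obtain ⟨-, hQk⟩ := Finset.mem_filter.1 hQ
      have hfl : (⌊(Q.card : ℝ) / κ⌋₊ : ℝ) ≤ Q.card / κ := Nat.floor_le (by positivity)
      rw [le_div_iff₀ hκ0] at hfl
      have hQk' : (⌊(Q.card : ℝ) / κ⌋₊ : ℝ) = k - 1 := by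
        rw [← hQk]; simp [a]
      rw [hQk'] at hfl
      rw [← Real.exp_log (show (0 : ℝ) < μ ^ (6 * k) by positivity), ← Real.exp_neg,
        Real.log_pow]
      refine mul_le_mul_of_nonneg_left (Real.exp_le_exp.2 (neg_le_neg ?_)) (by norm_num)
      push_cast
      calc 6 * (k : ℝ) * Real.log μ = (η ^ 2 * κ) * (k / 4) := by rw [hηκ]; ring
        _ ≤ (η ^ 2 * κ) * ((k - 1) / 2) :=
            mul_le_mul_of_nonneg_left (by linarith) (by positivity)
        _ = η ^ 2 / 2 * ((k - 1) * κ) := by ring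
        _ ≤ _ := mul_le_mul_of_nonneg_left hfl (by positivity)
    have hnum : ((nonzeroSupports A).filter (fun Q => a Q = k)).card ≤ μ ^ (3 * k) := by
      refine le_trans (Finset.card_le_card fun Q hQ => ?_)
        (hA.card_lightSupports_le hκ0 k hcard
          ((finrank_le_card_codeSupport A).trans (by omega)))
      obtain ⟨hQ, hQk⟩ := Finset.mem_filter.1 hQ
      refine mem_lightSupports.2 ⟨(mem_nonzeroSupports.1 hQ).2, ?_⟩
      have := (Nat.lt_floor_add_one ((Q.card : ℝ) / κ)).le
      rw [div_le_iff₀ hκ0] at this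
      rw [← hQk]
      simpa [a] using this
    refine (Finset.sum_le_card_nsmul _ _ _ hterm).trans ?_
    rw [nsmul_eq_mul]
    have hnum' : (((nonzeroSupports A).filter (fun Q => a Q = k)).card : ℝ) ≤
        (μ : ℝ) ^ (3 * k) := by exact_mod_cast hnum
    calc _ ≤ (μ : ℝ) ^ (3 * k) * (2 * ((μ : ℝ) ^ (6 * k))⁻¹) :=
          mul_le_mul_of_nonneg_right hnum' (by positivity)
      _ = 2 * ((μ : ℝ) ^ (3 * k))⁻¹ := by
          rw [show 6 * k = 3 * k + 3 * k by ring, pow_add]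
          field_simp
      _ ≤ 2 * ((μ : ℝ) ^ 6)⁻¹ := by
          refine mul_le_mul_of_nonneg_left (inv_anti₀ (by positivity) ?_) (by norm_num)
          exact pow_le_pow_right₀ (by linarith) (by omega)
  refine (Finset.sum_le_card_nsmul _ _ _ hfib).trans_lt ?_
  rw [nsmul_eq_mul, Nat.card_Icc, show μ + 1 - 2 = μ - 1 by omega, Nat.cast_sub (by omega)]
  have h6 : (μ : ℝ) ^ 6 = μ * μ * μ ^ 4 := by ring
  have h4 : (2 : ℝ) ≤ μ ^ 4 := hμR.trans (le_self_pow₀ (by linarith) (by norm_num))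
  rw [← div_eq_mul_inv, ← mul_div_assoc, div_lt_div_iff₀ (by positivity) hμ0, h6]
  push_cast
  have : (μ : ℝ) * μ * 2 ≤ μ * μ * μ ^ 4 := mul_le_mul_of_nonneg_left h4 (by positivity)
  nlinarith

end Potential

/-! ### One halving step for a weighted code. -/

section Halving

variable {ι F : Type*} [Fintype ι] [Field F]

/-- One step of sparsification: half of the coordinates, up to `O(dim C * log / η ^ 2)` many,
are dropped at the cost of a relative error `η`. -/
lemma exists_halving (C : Submodule F (ι → F)) (W : ι → ℝ≥0) {η : ℝ} (hη : 0 < η)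
    (hη1 : η ≤ 1) {μ : ℕ} (hμ : 2 ≤ μ) (hcard : (Function.support W).ncard + 1 ≤ μ) :
    ∃ W' : ι → ℝ≥0,
      ((Function.support W').ncard : ℝ) ≤ (Function.support W).ncard / 2 +
        24 * Real.log μ / η ^ 2 * Module.finrank F C ∧
      ∀ c ∈ C, |∑ i ∈ wordSupport c, (W' i : ℝ) - ∑ i ∈ wordSupport c, (W i : ℝ)| ≤
        η * ∑ i ∈ wordSupport c, (W i : ℝ) := by
  classical
  set κ : ℝ := 24 * Real.log μ / η ^ 2 with hκdef
  have hκ0 : 0 ≤ κ := div_nonneg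
    (mul_nonneg (by norm_num) (Real.log_natCast_nonneg μ)) (by positivity)
  set S : Finset ι := Finset.univ.filter fun i => W i ≠ 0 with hS
  have hsupp : ∀ V : ι → ℝ≥0,
      (Function.support V).ncard = (Finset.univ.filter fun i => V i ≠ 0).card := fun V => by
    rw [← Set.ncard_coe_finset]
    congr 1
    ext i
    simp
  have hSc : (Function.support W).ncard = S.card := hsupp W
  rw [hSc] at hcard ⊢
  let D : ι → Finset ι := fun i => strongCore κ C (S.filter fun j => W i ≤ W j)
  have hDS : ∀ i, D i ⊆ S := fun i =>
    (strongCore_subset _ _ _).trans (Finset.filter_subset _ _)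
  have hD : ∀ i, IsStrongCode κ (puncturedCode C (D i)) := fun i => isStrongCode_strongCore _ _ _
  set R : Finset ι := S.filter fun i => i ∈ D i with hR
  -- Cores grow as the threshold falls. Hence the part of `R` above level `W i` lies in the single
  -- strong set `D i`, and only supports of the code punctured to `D i` matter at that level.
  have hRD : ∀ i, ∀ j ∈ R, W i ≤ W j → j ∈ D i := fun i j hj hij => by
    refine strongCore_mono κ C (fun k hk => ?_) (Finset.mem_filter.1 hj).2
    obtain ⟨hk, hjk⟩ := Finset.mem_filter.1 hk
    exact Finset.mem_filter.2 ⟨hk, hij.trans hjk⟩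
  let J : Finset (Σ _ : ι, Finset ι) := S.sigma fun i => nonzeroSupports (puncturedCode C (D i))
  let T : (Σ _ : ι, Finset ι) → Finset ι := fun p => (R.filter fun j => W p.1 ≤ W j) ∩ p.2
  have hJ : ∑ p ∈ J, 2 * Real.exp (-(η ^ 2 / 2 * p.2.card)) < 1 := by
    rw [Finset.sum_sigma]
    have h1 : ∀ i ∈ S, ∑ Q ∈ nonzeroSupports (puncturedCode C (D i)),
        2 * Real.exp (-(η ^ 2 / 2 * Q.card)) ≤ 1 / (μ : ℝ) := fun i _ => by
      refine ((hD i).sum_exp_le hη hη1 hμ (le_trans (Nat.add_le_add_right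
        (Finset.card_le_card ?_) 1) hcard)).le
      exact (codeSupport_puncturedCode_subset _ _).trans (hDS i)
    refine (Finset.sum_le_card_nsmul _ _ _ h1).trans_lt ?_
    rw [nsmul_eq_mul, mul_one_div, div_lt_one (by positivity)]
    exact_mod_cast hcard
  obtain ⟨X, hX, hXR⟩ := exists_boolSign_sum_le_and_card_le J T (fun p => p.2)
    (fun _ _ => Finset.inter_subset_right) hη hJ R
  have hdisc : ∀ c ∈ C, ∀ i ∈ S,
      |∑ j ∈ (R ∩ wordSupport c).filter (fun j => W i ≤ W j), boolSign (X j)| ≤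
        η * ((S ∩ wordSupport c).filter fun j => W i ≤ W j).card := by
    intro c hc i hi
    set Q : Finset ι := wordSupport c ∩ D i with hQ
    have hQE : Q ⊆ (S ∩ wordSupport c).filter fun j => W i ≤ W j := fun j hj => by
      obtain ⟨h1, h2⟩ := Finset.mem_inter.1 hj
      obtain ⟨h3, h4⟩ := Finset.mem_filter.1 (strongCore_subset _ _ _ h2)
      exact Finset.mem_filter.2 ⟨Finset.mem_inter.2 ⟨h3, h1⟩, h4⟩
    have hTQ : (R ∩ wordSupport c).filter (fun j => W i ≤ W j) = T ⟨i, Q⟩ := by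
      ext j
      simp only [T, Q, Finset.mem_filter, Finset.mem_inter]
      constructor
      · rintro ⟨⟨h1, h2⟩, h3⟩
        exact ⟨⟨h1, h3⟩, h2, hRD i j h1 h3⟩
      · rintro ⟨⟨h1, h3⟩, h2, -⟩
        exact ⟨⟨h1, h2⟩, h3⟩
    rw [hTQ]
    rcases Q.eq_empty_or_nonempty with h0 | hne
    · simp only [T, h0, Finset.inter_empty, Finset.sum_empty, abs_zero]
      positivity
    · refine (hX ⟨i, Q⟩ (Finset.mem_sigma.2 ⟨hi, mem_nonzeroSupports.2 ⟨hne,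
        restrictTo F (D i) c, ⟨c, hc, rfl⟩, wordSupport_restrictTo _ _⟩⟩)).trans ?_
      exact mul_le_mul_of_nonneg_left (Nat.cast_le.2 (Finset.card_le_card hQE)) hη.le
  refine ⟨fun i => if i ∈ R then (if X i = true then 2 * W i else 0) else W i, ?_, ?_⟩
  · rw [hsupp]
    have hsub : (Finset.univ.filter fun i =>
        (if i ∈ R then (if X i = true then 2 * W i else 0) else W i) ≠ 0) ⊆
        (R.filter fun i => X i = true) ∪ (S \ R) := by
      intro i hi
      have hi := (Finset.mem_filter.1 hi).2
      by_cases hiR : i ∈ R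
      · by_cases hXi : X i = true
        · simp [hiR, hXi]
        · simp [hiR, hXi] at hi
      · simp only [hiR, if_false] at hi
        simp [hiR, hS, hi]
    have hK : ((S \ R).card : ℝ) ≤ κ * Module.finrank F C := by
      refine (card_le_of_forall_not_isStrongCode hκ0 C (S \ R) fun A hA hAs => ?_).trans
        (mul_le_mul_of_nonneg_left (Nat.cast_le.2 (finrank_puncturedCode_le _ _)) hκ0)
      by_contra hne
      -- A lightest element of a strong set `A` has all of `A` in its superlevel set, hence lies in
      -- its own core and so in `R`.
      obtain ⟨i, hi, hmin⟩ :=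
        Finset.exists_min_image A W (Finset.nonempty_iff_ne_empty.2 hne)
      obtain ⟨hiS, hiR⟩ := Finset.mem_sdiff.1 (hA hi)
      refine hiR (Finset.mem_filter.2 ⟨hiS, subset_strongCore (fun j hj => ?_) hAs hi⟩)
      exact Finset.mem_filter.2 ⟨(Finset.mem_sdiff.1 (hA hj)).1, hmin j hj⟩
    have h1 : ((Finset.univ.filter fun i =>
        (if i ∈ R then (if X i = true then 2 * W i else 0) else W i) ≠ 0).card : ℝ) ≤
        (R.filter fun i => X i = true).card + (S \ R).card := by
      exact_mod_cast (Finset.card_le_card hsub).trans (Finset.card_union_le _ _)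
    have h2 : 2 * ((R.filter fun i => X i = true).card : ℝ) ≤ S.card := by
      exact_mod_cast hXR.trans (Finset.card_le_card (Finset.filter_subset _ _))
    linarith
  · intro c hc
    have hzero : ∀ h : ι → ℝ, ∑ i ∈ wordSupport c, (W i : ℝ) * h i =
        ∑ i ∈ S ∩ wordSupport c, (W i : ℝ) * h i := fun h => by
      symm
      refine Finset.sum_subset Finset.inter_subset_right fun i hi hiS => ?_
      have : W i = 0 := by
        by_contra hW
        exact hiS (Finset.mem_inter.2 ⟨Finset.mem_filter.2 ⟨Finset.mem_univ i, hW⟩, hi⟩)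
      simp [this]
    let x : ι → ℝ := fun i => if i ∈ R then boolSign (X i) else 0
    have hdiff : ∑ i ∈ wordSupport c,
          (((if i ∈ R then (if X i = true then 2 * W i else 0) else W i : ℝ≥0)) : ℝ) -
        ∑ i ∈ wordSupport c, (W i : ℝ) = ∑ i ∈ S ∩ wordSupport c, (W i : ℝ) * x i := by
      rw [← Finset.sum_sub_distrib, ← hzero]
      refine Finset.sum_congr rfl fun i _ => ?_
      by_cases hiR : i ∈ R
      · by_cases hXi : X i = true
        · simp [x, hiR, hXi, boolSign]; ring
        · simp [x, hiR, hXi, boolSign]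
      · simp [x, hiR]
    have htot : η * ∑ i ∈ wordSupport c, (W i : ℝ) =
        ∑ i ∈ S ∩ wordSupport c, (W i : ℝ) * η := by
      rw [← hzero, Finset.mul_sum]
      exact Finset.sum_congr rfl fun i _ => mul_comm _ _
    have hlev : ∀ i ∈ S ∩ wordSupport c,
        |∑ j ∈ (S ∩ wordSupport c).filter (fun j => (W i : ℝ) ≤ W j), x j| ≤
          ∑ j ∈ (S ∩ wordSupport c).filter (fun j => (W i : ℝ) ≤ W j), η := by
      intro i hi
      have h := hdisc c hc i (Finset.mem_inter.1 hi).1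
      have h1 : ∑ j ∈ (S ∩ wordSupport c).filter (fun j => (W i : ℝ) ≤ W j), x j =
          ∑ j ∈ (R ∩ wordSupport c).filter (fun j => W i ≤ W j), boolSign (X j) := by
        simp only [x, ← Finset.sum_filter]
        refine Finset.sum_congr ?_ fun _ _ => rfl
        ext j
        simp only [Finset.mem_filter, Finset.mem_inter, hR, NNReal.coe_le_coe]
        tauto
      rw [h1, Finset.sum_const, nsmul_eq_mul, mul_comm]
      simpa only [NNReal.coe_le_coe] using h
    rw [hdiff, htot, abs_le]
    constructor
    -- The unweighted discrepancy bounds on superlevel sets become a weighted bound, applied to `η +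
    -- x` and then to `η - x`.
    · have := sum_mul_nonneg_of_superlevel_nonneg (fun i => η + x i) (S ∩ wordSupport c)
        (fun i => (W i : ℝ)) (fun i _ => NNReal.coe_nonneg _) fun i hi _ => by
          rw [Finset.sum_add_distrib]
          linarith [(abs_le.1 (hlev i hi)).1]
      simp only [mul_add, Finset.sum_add_distrib] at this
      linarith
    · have := sum_mul_nonneg_of_superlevel_nonneg (fun i => η - x i) (S ∩ wordSupport c)
        (fun i => (W i : ℝ)) (fun i _ => NNReal.coe_nonneg _) fun i hi _ => by
          rw [Finset.sum_sub_distrib]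
          linarith [(abs_le.1 (hlev i hi)).2]
      simp only [mul_sub, Finset.sum_sub_distrib] at this
      linarith

end Halving

/-! ### Iterated halving. -/

section Iteration

variable {ι F : Type*} [Fintype ι] [Field F]

/-- Iterated halving down to length `T`, with geometrically growing errors. -/
lemma exists_iterated_halving (C : Submodule F (ι → F)) {ε T : ℝ} (hε : 0 < ε) (hε1 : ε ≤ 1)
    (hT1 : 1 ≤ T)
    (hT : 192000 * (Real.log (3 * T) + 1) * Module.finrank F C ≤ T * ε ^ 2) (j : ℕ) :
    ∀ W : ι → ℝ≥0, ((Function.support W).ncard : ℝ) ≤ T * (3 / 2) ^ j →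
      ∃ W' : ι → ℝ≥0, ((Function.support W').ncard : ℝ) ≤ T ∧
        ∀ c ∈ C, |∑ i ∈ wordSupport c, (W' i : ℝ) - ∑ i ∈ wordSupport c, (W i : ℝ)| ≤
          ε * (1 - (9 / 10) ^ j) * ∑ i ∈ wordSupport c, (W i : ℝ) := by
  induction j with
  | zero =>
    intro W hW
    exact ⟨W, by simpa using hW, fun c _ => by simp⟩
  | succ j ih =>
    intro W hW
    set M : ℕ := (Function.support W).ncard
    -- The budget grows by `ε * (9 / 10) ^ j / 10 = 2 * η`: one `η` for this step, one for applying
    -- the later error, at most `1`, to the perturbed weight.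
    set η : ℝ := ε * (9 / 10) ^ j / 20 with hη
    set n : ℝ := (Module.finrank F C : ℝ)
    have hn : 0 ≤ n := Nat.cast_nonneg _
    have hρ0 : (0 : ℝ) < (9 / 10) ^ j := by positivity
    have hρ1 : ((9 : ℝ) / 10) ^ j ≤ 1 := pow_le_one₀ (by norm_num) (by norm_num)
    have hη0 : 0 < η := by positivity
    have hη1 : η ≤ 1 := by
      have : ε * (9 / 10) ^ j ≤ 1 := mul_le_one₀ hε1 hρ0.le hρ1
      rw [hη]
      linarith
    obtain ⟨W₁, hW₁, hW₁c⟩ := exists_halving C W hη0 hη1 (μ := M + 2) (by omega) (by omega)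
    have hlogT : 0 ≤ Real.log (3 * T) := Real.log_nonneg (by linarith)
    have hlog : Real.log ((M + 2 : ℕ) : ℝ) ≤ (Real.log (3 * T) + 1) * (5 * (6 / 5) ^ j) := by
      have h1 : (1 : ℝ) ≤ (3 / 2) ^ (j + 1) := one_le_pow₀ (by norm_num)
      have h2 : ((M + 2 : ℕ) : ℝ) ≤ 3 * T * (3 / 2) ^ (j + 1) := by
        push_cast
        nlinarith
      have h3 := Real.log_le_log (by positivity) h2
      rw [Real.log_mul (by positivity) (by positivity), Real.log_pow] at h3
      have h4 : Real.log (3 / 2) ≤ 1 := (Real.log_le_sub_one_of_pos (by norm_num)).trans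
        (by norm_num)
      have h5 : 1 + (j : ℝ) * (1 / 5) ≤ (6 / 5) ^ j := by
        have := one_add_mul_le_pow (a := (1 / 5 : ℝ)) (by norm_num) j
        norm_num at this ⊢
        exact this
      have hj0 : (0 : ℝ) ≤ j := Nat.cast_nonneg _
      calc _ ≤ Real.log (3 * T) + ((j + 1 : ℕ) : ℝ) * Real.log (3 / 2) := h3
        _ ≤ Real.log (3 * T) + (j + 1) := by
            push_cast
            nlinarith
        _ ≤ (Real.log (3 * T) + 1) * (1 + j) := by nlinarith
        _ ≤ _ := mul_le_mul_of_nonneg_left (by linarith) (by linarith)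
    -- The kept coordinates take a quarter of the target and the halved ones three quarters. The
    -- rates fit because `6 / 5 ≤ (3 / 2) * (81 / 100)`, and `192000 = 24 * 5 * 400 * 4`.
    have hdrop : 24 * Real.log ((M + 2 : ℕ) : ℝ) / η ^ 2 * n ≤ T * (3 / 2) ^ j / 4 := by
      have hη2 : η ^ 2 = ε ^ 2 * (81 / 100) ^ j / 400 := by
        rw [hη, div_pow, mul_pow, ← pow_mul, mul_comm j 2, pow_mul]
        norm_num
      rw [div_mul_eq_mul_div, div_le_iff₀ (by positivity), hη2]
      have h6 : ((6 : ℝ) / 5) ^ j ≤ (3 / 2) ^ j * (81 / 100) ^ j := by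
        rw [← mul_pow]
        exact pow_le_pow_left₀ (by norm_num) (by norm_num) j
      calc 24 * Real.log ((M + 2 : ℕ) : ℝ) * n
          ≤ 24 * ((Real.log (3 * T) + 1) * (5 * (6 / 5) ^ j)) * n :=
            mul_le_mul_of_nonneg_right (mul_le_mul_of_nonneg_left hlog (by norm_num)) hn
        _ = (192000 * (Real.log (3 * T) + 1) * n) * (6 / 5) ^ j / 1600 := by ring
        _ ≤ (T * ε ^ 2) * ((3 / 2) ^ j * (81 / 100) ^ j) / 1600 := by gcongr
        _ = _ := by ring
    obtain ⟨W', hW', hW'c⟩ := ih W₁ (by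
      refine hW₁.trans ?_
      rw [pow_succ] at hW
      linarith)
    refine ⟨W', hW', fun c hc => ?_⟩
    have h1 := hW₁c c hc
    have h2 := hW'c c hc
    set s : ℝ := ∑ i ∈ wordSupport c, (W i : ℝ)
    set s₁ : ℝ := ∑ i ∈ wordSupport c, (W₁ i : ℝ)
    set s' : ℝ := ∑ i ∈ wordSupport c, (W' i : ℝ)
    have hs : 0 ≤ s := Finset.sum_nonneg fun i _ => NNReal.coe_nonneg _
    set φ : ℝ := ε * (1 - (9 / 10) ^ j) with hφ
    have hφ0 : 0 ≤ φ := mul_nonneg hε.le (by linarith)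
    have hφ1 : φ ≤ 1 := mul_le_one₀ hε1 (by linarith) (by linarith)
    have h3 : ε * (1 - (9 / 10) ^ (j + 1)) = φ + 2 * η := by
      rw [hφ, hη, pow_succ]
      ring
    have h4 : s₁ ≤ (1 + η) * s := by linarith [(abs_le.1 h1).2]
    have h5 : φ * s₁ ≤ φ * s + η * s := by
      have h7 : φ * (η * s) ≤ 1 * (η * s) :=
        mul_le_mul_of_nonneg_right hφ1 (mul_nonneg hη0.le hs)
      have h8 := mul_le_mul_of_nonneg_left h4 hφ0
      linarith
    rw [h3]
    have h6 := abs_sub_le s' s₁ s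
    linarith

end Iteration

/-! ### Choice of the target length and conclusion. -/

lemma weightedHammingWeight_eq_sum {F : Type*} [Field F] {m : ℕ} (w : Fin m → ℝ≥0)
    (c : Fin m → F) : weightedHammingWeight w c = ∑ i ∈ wordSupport c, (w i : ℝ) := by
  simp [weightedHammingWeight, wordSupport, Finset.sum_filter]

/-- Every code of positive dimension `n` has a `(1 ± ε)` sparsifier of size
`O(n * log (n / ε) / ε ^ 2)`. -/
lemma exists_isCodeSparsifier {F : Type*} [Field F] {m : ℕ} (C : Submodule F (Fin m → F))
    {n : ℕ} (hC : Module.finrank F C = n) (hn : 1 ≤ n) {ε : ℝ} (hε : 0 < ε) (hε1 : ε ≤ 1) :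
    ∃ w : Fin m → ℝ≥0, IsCodeSparsifier C ε w ∧
      ((Function.support w).ncard : ℝ) ≤ n * (10 ^ 7 * (1 + Real.log (n / ε))) / ε ^ 2 := by
  have hnR : (1 : ℝ) ≤ n := by exact_mod_cast hn
  set x : ℝ := n / ε with hx
  have hx1 : 1 ≤ x := by
    rw [hx, le_div_iff₀ hε]
    linarith
  have hlogx : 0 ≤ Real.log x := Real.log_nonneg hx1
  set T : ℝ := n * (10 ^ 7 * (1 + Real.log x)) / ε ^ 2 with hTdef
  have hε2 : ε ^ 2 ≤ 1 := pow_le_one₀ hε.le hε1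
  have hT1 : 1 ≤ T := by
    rw [hTdef, le_div_iff₀ (by positivity)]
    nlinarith
  have hTx : 3 * T ≤ 2 ^ 25 * x ^ 3 := by
    have h1 : n / ε ^ 2 ≤ x ^ 2 := by
      rw [hx, div_pow]
      gcongr
      exact le_self_pow₀ hnR (by norm_num)
    have h2 : 1 + Real.log x ≤ x := by
      linarith [Real.log_le_sub_one_of_pos (show 0 < x by linarith)]
    calc 3 * T = 3 * 10 ^ 7 * ((n / ε ^ 2) * (1 + Real.log x)) := by rw [hTdef]; ring
      _ ≤ 3 * 10 ^ 7 * (x ^ 2 * x) := by gcongr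
      _ ≤ 2 ^ 25 * (x ^ 2 * x) := by gcongr; norm_num
      _ = _ := by ring
  have hlogT : Real.log (3 * T) ≤ 25 + 3 * Real.log x := by
    have h := Real.log_le_log (by positivity) hTx
    rw [Real.log_mul (x := 2 ^ 25) (by positivity) (by positivity), Real.log_pow,
      Real.log_pow] at h
    push_cast at h
    linarith [Real.log_two_lt_d9]
  have hT : 192000 * (Real.log (3 * T) + 1) * Module.finrank F C ≤ T * ε ^ 2 := by
    have h1 : T * ε ^ 2 = 10 ^ 7 * (1 + Real.log x) * n := by
      rw [hTdef, div_mul_cancel₀ _ (by positivity), mul_comm]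
    rw [hC, h1]
    exact mul_le_mul_of_nonneg_right (by linarith) (by linarith)
  -- The length `m` influences only the number of rounds, not `T` or the final error.
  obtain ⟨j, hj⟩ := pow_unbounded_of_one_lt (m : ℝ) (show (1 : ℝ) < 3 / 2 by norm_num)
  have hsupp : ((Function.support (1 : Fin m → ℝ≥0)).ncard : ℝ) ≤ T * (3 / 2) ^ j := by
    have h1 : (Function.support (1 : Fin m → ℝ≥0)).ncard ≤ m := by
      simp
    have h2 : ((Function.support (1 : Fin m → ℝ≥0)).ncard : ℝ) ≤ m := by exact_mod_cast h1
    have h3 : 1 * (3 / 2 : ℝ) ^ j ≤ T * (3 / 2) ^ j :=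
      mul_le_mul_of_nonneg_right hT1 (by positivity)
    linarith
  obtain ⟨w, hw, hwc⟩ := exists_iterated_halving C hε hε1 hT1 hT j 1 hsupp
  refine ⟨w, fun c hc => ?_, hw⟩
  have h := hwc c hc
  rw [weightedHammingWeight_eq_sum, weightedHammingWeight_eq_sum]
  set s : ℝ := ∑ i ∈ wordSupport c, (((1 : Fin m → ℝ≥0) i : ℝ≥0) : ℝ)
  have hs : 0 ≤ s := Finset.sum_nonneg fun i _ => NNReal.coe_nonneg _
  have hφ : ε * (1 - (9 / 10) ^ j) * s ≤ ε * s := by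
    refine mul_le_mul_of_nonneg_right (mul_le_of_le_one_right hε.le ?_) hs
    have : (0 : ℝ) < (9 / 10) ^ j := by positivity
    linarith
  obtain ⟨h1, h2⟩ := abs_le.1 (h.trans hφ)
  constructor <;> linarith

theorem mainTheorem5 :
    ∃ δ : ℝ → ℝ, Tendsto δ atTop (𝓝 0) ∧
      ∃ x₀ K : ℝ,
        ∀ (F : Type*) [Field F] [Finite F] (m n : ℕ) (C : Submodule F (Fin m → F)),
          Module.finrank F C = n →
          ∀ ε : ℝ, 0 < ε →
            ∃ w : Fin m → ℝ≥0, IsCodeSparsifier C ε w ∧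
              (x₀ ≤ n / ε →
                ((Function.support w).ncard : ℝ) ≤
                  n * Real.log (n / ε) ^ (2 + δ (n / ε)) / ε ^ 2) ∧
              (n / ε < x₀ →
                ((Function.support w).ncard : ℝ) ≤ K * n / ε ^ 2) := by
  -- With `L = log (n / ε)`, the bound `10 ^ 7 * (1 + L)` is at most `L ^ 2` once `L ≥ 10 ^ 7 + 2`,
  -- and at most `K` below that threshold.
  refine ⟨fun _ => 0, tendsto_const_nhds, Real.exp (10 ^ 7 + 2), 10 ^ 7 * (10 ^ 7 + 3), ?_⟩
  intro F _ _ m n C hC ε hε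
  have hlog : Real.exp (10 ^ 7 + 2) ≤ n / ε → 10 ^ 7 + 2 ≤ Real.log (n / ε) := fun h => by
    simpa only [Real.log_exp] using Real.log_le_log (Real.exp_pos _) h
  by_cases htriv : n = 0 ∨ 1 < ε
  -- For `ε > 1` the lower bound is nonpositive, and for `n = 0` only the zero word occurs, so zero
  -- weights suffice.
  · refine ⟨0, fun c hc => ?_, fun h => ?_, fun _ => ?_⟩
    · rw [weightedHammingWeight_eq_sum, weightedHammingWeight_eq_sum]
      have hs : 0 ≤ ∑ i ∈ wordSupport c, (((1 : Fin m → ℝ≥0) i : ℝ≥0) : ℝ) :=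
        Finset.sum_nonneg fun i _ => NNReal.coe_nonneg _
      have h0 : ∑ i ∈ wordSupport c, (((0 : Fin m → ℝ≥0) i : ℝ≥0) : ℝ) = 0 := by simp
      rw [h0]
      refine ⟨?_, by positivity⟩
      rcases htriv with rfl | h1
      · have hc0 : c = 0 := by
          rw [Submodule.finrank_eq_zero.1 hC] at hc
          simpa using hc
        simp [hc0, wordSupport]
      · exact mul_nonpos_of_nonpos_of_nonneg (by linarith) hs
    · have := hlog h
      have h2 : 0 ≤ Real.log (n / ε) := by linarith
      simp only [Function.support_zero, Set.ncard_empty, Nat.cast_zero]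
      positivity
    · simp only [Function.support_zero, Set.ncard_empty, Nat.cast_zero]
      positivity
  · push Not at htriv
    have hn : 1 ≤ n := Nat.one_le_iff_ne_zero.2 htriv.1
    obtain ⟨w, hw, hcard⟩ := exists_isCodeSparsifier C hC hn hε htriv.2
    have hpos : 0 < (n : ℝ) / ε := div_pos (by exact_mod_cast hn) hε
    refine ⟨w, hw, fun h => hcard.trans ?_, fun h => hcard.trans ?_⟩
    · have := hlog h
      rw [add_zero, Real.rpow_two]
      gcongr
      nlinarith
    · have h1 : Real.log (n / ε) < 10 ^ 7 + 2 := (Real.log_lt_iff_lt_exp hpos).2 h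
      have h2 : (10 : ℝ) ^ 7 * (1 + Real.log (n / ε)) ≤ 10 ^ 7 * (10 ^ 7 + 3) := by linarith
      rw [mul_comm (n : ℝ)]
      gcongr
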